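/- There is an absolute constant $C>0$ such that the following holds. Consider a finite-horizon episodic Markov decision process with finite state space $\mathcal S$ ($|\mathcal S|=S$), finite action space $\mathcal A$ ($|\mathcal A|=A$), horizon $H$, initial distribution $p$ and non-stationary transition kernel $P(s'\mid s,a,h)$, $h\in[H]$, with $P(\cdot\mid s,a,H)=p$. Let $T$ be the number of episodes, $\delta,\rho\in(0,1)$, $\eta>0$, $\lambda_1\ge 0$, and let $\psi$ be a reference function with Bregman divergence $D(\lambda,\lambda')=\psi(\lambda)-\psi(\lambda')-\psi'(\lambda')(\lambda-\lambda')$. In episode $t\in[T]$ reward and consumption functions $f_t,g_t:\mathcal S\times\mathcal A\times[H]\to[0,1]$ are revealed at the beginning of the episode (they may be random); they vanish at a default action $a^\star\in\mathcal A$. Let $\mathcal F_t$ be the $\sigma$-algebra generated by $f_1,g_1,\dots,f_t,g_t$ and the trajectories of episodes $1,\dots,t-1$. The decision-maker runs online dual mirror descent. At the beginning of episode $t$, let $N_t(s,a,h)$ and $M_t(s,a,s',h)$ count the previous visits to $(s,a)$ at step $h$, and those followed by $s'$; put $\bar P_t(s'\mid s,a,h)=M_t(s,a,s',h)/\max\{1,N_t(s,a,h)\}$,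 $$\epsilon_t(s'\mid s,a,h)=2\sqrt{\frac{\bar P_t(s'\mid s,a,h)\ln(HSAT/\delta)}{\max\{1,N_t(s,a,h)-1\}}}+\frac{14\ln(HSAT/\delta)}{3\max\{1,N_t(s,a,h)-1\}},$$ and let $\mathcal P_t$ be the set of kernels $\widehat P$ with $|\widehat P-\bar P_t|\le\epsilon_t$ entrywise. Let $\Delta(P,t)$ be the set of $q\in[0,1]^{\mathcal S\times\mathcal A\times[H]}$ of the form $q(s,a,h)=\sum_{s'}\bar q(s,a,s',h)$ with $\bar q\in[0,1]^{\mathcal S\times\mathcal A\times\mathcal S\times[H]}$, $\sum_{s,a,s'}\bar q(s,a,s',h)=1$ for all $h$, $\sum_{s',a}\bar q(s,a,s',h)=\sum_{s',a}\bar q(s',a,s,h-1)$ for $h\ge2$ and all $s$, and $\bar q(s,a,s',h)=\widehat P(s'\mid s,a,h)\,q(s,a,h)$ for some $\widehat P\in\mathcal P_t$. The algorithm picks $\widehat q_t\in\arg\max_{q\in\Delta(P,t)}\{\langle f_t,q\rangle-\lambda_t\langle g_t,q\rangle\}$, and an $\mathcal F_t$-measurable policy $\pi_t$ with $\pi_t(a\mid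 s,h)\sum_b\widehat q_t(s,b,h)=\widehat q_t(s,a,h)$; it draws $s_1\sim p$ and, for $h=1,\dots,H$, $a_h\sim\pi_t(\cdot\mid s_h,h)$ and $s_{h+1}\sim P(\cdot\mid s_h,a_h,h)$; and it sets $\lambda_{t+1}\in\arg\min_{\lambda\ge0}\{\eta(H\rho-\langle g_t,\widehat q_t\rangle)\lambda+D(\lambda,\lambda_t)\}$. It terminates after the first step at which the remaining budget ($TH\rho$ minus the total consumption so far) is less than $1$. From then on every action is $a^\star$, and $\pi_t(a^\star\mid s,h)=1$ in every later episode $t$. Let $q_t(s,a,h)$ be the probability that a trajectory generated by $p$, $P$ and the policy $\pi_t$ has $s_h=s$ and $a_h=a$. Then, with probability at least $1-5\delta$, the gap between the expected and the realized rewards satisfies $$\left|\sum_{t=1}^T\langle f_t,q_t\rangle-\sum_{t=1}^T\sum_{h=1}^H f_t(s_h,a_h,h)\right|\le C\left(H\sqrt T+H^2S\sqrt A\right)\left(\ln\frac{HSAT}{\delta}\right)^2,$$ where in the second sum $(s_h,a_h)$ is the state-action pair at step $h$ of episode $t$. -/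

import Mathlib

open MeasureTheory ProbabilityTheory

noncomputable section

namespace EpisodicMDP

/-- A probability vector on a finite type. -/
def IsProbVec {X : Type*} [Fintype X] (v : X → ℝ) : Prop :=
  (∀ x, 0 ≤ v x) ∧ ∑ x, v x = 1

/-- A function of (state, action, step). Steps `1, …, H` are indexed by `Fin H`. -/
abbrev SAH (S A : Type*) (H : ℕ) := S → A → Fin H → ℝ

/-- A non-stationary kernel: `K s a h s'` is the probability `K(s' ∣ s, a, h)`. -/
abbrev Ker (S A : Type*) (H : ℕ) := S → A → Fin H → S → ℝ

/-- A policy: `π s h a` is the probability `π(a ∣ s, h)`. -/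
abbrev Pol (S A : Type*) (H : ℕ) := S → Fin H → A → ℝ

/-- `K` is a transition kernel. -/
def IsKernel {S A : Type*} [Fintype S] {H : ℕ} (K : Ker S A H) : Prop :=
  ∀ s a h, IsProbVec (K s a h)

/-- `π` is a stochastic non-stationary policy. -/
def IsPolicy {S A : Type*} [Fintype A] {H : ℕ} (π : Pol S A H) : Prop :=
  ∀ s h, IsProbVec (π s h)

/-- Finite-horizon MDP with horizon `H`: initial distribution `p` and non-stationary transition
kernel `P`, with the convention that the transition out of the last step has law `p`. -/
structure MDP (S A : Type*) [Fintype S] (H : ℕ) where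
  P : Ker S A H
  p : S → ℝ
  P_isKernel : IsKernel P
  p_isProbVec : IsProbVec p
  P_last : ∀ s a (h : Fin H), (h : ℕ) + 1 = H → P s a h = p

/-- The probability of the trajectory `s₁, a₁, …, s_H, a_H, s_{H+1}` under the MDP and policy. -/
def trajProb {S A : Type*} [Fintype S] {H : ℕ} (M : MDP S A H) (π : Pol S A H)
    (x : Fin (H + 1) → S) (b : Fin H → A) : ℝ :=
  M.p (x 0) * ∏ h : Fin H, (π (x h.castSucc) h (b h) * M.P (x h.castSucc) (b h) h (x h.succ))

open Classical in
/-- The occupancy measure `q^{P,π}(s,a,h)`: the probability that the trajectory of `π` has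
`s_h = s` and `a_h = a`. -/
def occ {S A : Type*} [Fintype S] [Fintype A] {H : ℕ} (M : MDP S A H) (π : Pol S A H) :
    SAH S A H := fun s a h =>
  ∑ x : Fin (H + 1) → S, ∑ b : Fin H → A,
    if x h.castSucc = s ∧ b h = a then trajProb M π x b else 0

/-- The inner product of two vectors indexed by (state, action, step). -/
def dot {S A : Type*} [Fintype S] [Fintype A] {H : ℕ} (u v : SAH S A H) : ℝ :=
  ∑ s, ∑ a, ∑ h, u s a h * v s a h

/-- The random quantities of a run of the algorithm on a sample space `Ω`.
Episodes are numbered `0, 1, …` and steps by `Fin H`; `st t h` is the state at step `h` of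
episode `t`, with `st t (Fin.last H)` the state observed after the last action. -/
structure Run (S A Ω : Type*) (H : ℕ) where
  /-- reward functions -/
  f : ℕ → Ω → SAH S A H
  /-- resource consumption functions -/
  g : ℕ → Ω → SAH S A H
  /-- states -/
  st : ℕ → Fin (H + 1) → Ω → S
  /-- actions -/
  act : ℕ → Fin H → Ω → A
  /-- dual variables -/
  lam : ℕ → Ω → ℝ
  /-- optimistic occupancy measures -/
  qhat : ℕ → Ω → SAH S A H
  /-- policies -/
  pol : ℕ → Ω → Pol S A H

/-- The input of the algorithm: number `T` of episodes, confidence parameter `δ`, budget rate `ρ`,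
step size `η`, initial dual variable `lam₀`, and reference function `ψ`. -/
structure Params where
  T : ℕ
  δ : ℝ
  ρ : ℝ
  η : ℝ
  lam₀ : ℝ
  ψ : ℝ → ℝ
  δ_pos : 0 < δ
  δ_lt_one : δ < 1
  ρ_pos : 0 < ρ
  ρ_lt_one : ρ < 1
  η_pos : 0 < η
  lam₀_nonneg : 0 ≤ lam₀

/-- Bregman divergence on `[0, ∞)` of the reference function `ψ`. -/
def bregman (ψ : ℝ → ℝ) (l l' : ℝ) : ℝ :=
  ψ l - ψ l' - derivWithin ψ (Set.Ici 0) l' * (l - l')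

section Algorithm

variable {S A Ω : Type*} [Fintype S] [Fintype A] {H : ℕ}

/-- The logarithmic factor `ln (H S A T / δ)`. -/
def logFactor (S A : Type*) [Fintype S] [Fintype A] (H : ℕ) (c : Params) : ℝ :=
  Real.log ((H : ℝ) * Fintype.card S * Fintype.card A * c.T / c.δ)

open Classical in
/-- `N_t(s,a,h)`: visits to `(s,a,h)` in the episodes before `t`. -/
def visits (X : Run S A Ω H) (t : ℕ) (ω : Ω) (s : S) (a : A) (h : Fin H) : ℕ :=
  ((Finset.range t).filter fun j => X.st j h.castSucc ω = s ∧ X.act j h ω = a).card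

open Classical in
/-- `M_t(s,a,s',h)`: visits to `(s,a,s',h)` in the episodes before `t`. -/
def transVisits (X : Run S A Ω H) (t : ℕ) (ω : Ω) (s : S) (a : A) (s' : S) (h : Fin H) : ℕ :=
  ((Finset.range t).filter fun j =>
    X.st j h.castSucc ω = s ∧ X.act j h ω = a ∧ X.st j h.succ ω = s').card

/-- The empirical transition kernel of episode `t`. -/
def empKer (X : Run S A Ω H) (t : ℕ) (ω : Ω) : Ker S A H := fun s a h s' =>
  (transVisits X t ω s a s' h : ℝ) / max 1 (visits X t ω s a h : ℝ)

/-- The confidence radius `ε_t(s' ∣ s,a,h)`. -/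
def radius (c : Params) (X : Run S A Ω H) (t : ℕ) (ω : Ω) : Ker S A H := fun s a h s' =>
  2 * Real.sqrt (empKer X t ω s a h s' * logFactor S A H c /
      max 1 ((visits X t ω s a h : ℝ) - 1))
    + 14 * logFactor S A H c / (3 * max 1 ((visits X t ω s a h : ℝ) - 1))

/-- The confidence set `𝒫_t` of transition kernels. -/
def confSet (c : Params) (X : Run S A Ω H) (t : ℕ) (ω : Ω) : Set (Ker S A H) :=
  {K | IsKernel K ∧ ∀ s a s' h, |K s a h s' - empKer X t ω s a h s'| ≤ radius c X t ω s a h s'}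

/-- The relaxed feasible set `Δ(P,t)`: `q` is the marginal of some `qb` satisfying the flow
constraints, whose induced kernel `qb(s,a,s',h) / ∑_{s''} qb(s,a,s'',h)` lies in `𝒫_t`
(its values are free where the denominator vanishes). -/
def feasible (c : Params) (X : Run S A Ω H) (t : ℕ) (ω : Ω) : Set (SAH S A H) :=
  {q | (∀ s a h, 0 ≤ q s a h ∧ q s a h ≤ 1) ∧
    ∃ qb : Ker S A H,
      (∀ s a h s', 0 ≤ qb s a h s' ∧ qb s a h s' ≤ 1) ∧
      (∀ h, ∑ s, ∑ a, ∑ s', qb s a h s' = 1) ∧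
      (∀ s (k h : Fin H), (k : ℕ) + 1 = h →
        ∑ a, ∑ s', qb s a h s' = ∑ a, ∑ s', qb s' a k s) ∧
      (∀ s a h, q s a h = ∑ s', qb s a h s') ∧
      ∃ K ∈ confSet c X t ω, ∀ s a h s', qb s a h s' = K s a h s' * ∑ s'', qb s a h s''}

/-- The policy `π` is induced by `q`: `π(a ∣ s,h) = q(s,a,h) / ∑_b q(s,b,h)`
(with arbitrary values where the denominator vanishes). -/
def Induces (q : SAH S A H) (π : Pol S A H) : Prop :=
  ∀ s a h, π s h a * ∑ b, q s b h = q s a h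

/-- The budget that remains once step `h` of episode `t` has been carried out. -/
def remaining (c : Params) (X : Run S A Ω H) (t : ℕ) (h : Fin H) (ω : Ω) : ℝ :=
  (c.T : ℝ) * H * c.ρ
    - ∑ j ∈ Finset.range t, ∑ k : Fin H, X.g j ω (X.st j k.castSucc ω) (X.act j k ω) k
    - ∑ k ∈ Finset.Iic h, X.g t ω (X.st t k.castSucc ω) (X.act t k ω) k

/-- The algorithm has terminated during an episode before `t`. -/
def StoppedBy (c : Params) (X : Run S A Ω H) (t : ℕ) (ω : Ω) : Prop :=
  ∃ j < t, ∃ k : Fin H, remaining c X j k ω < 1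

/-- The algorithm has terminated before step `h` of episode `t`. -/
def StoppedBefore (c : Params) (X : Run S A Ω H) (t : ℕ) (h : Fin H) (ω : Ω) : Prop :=
  StoppedBy c X t ω ∨ ∃ k < h, remaining c X t k ω < 1

open Classical in
/-- The point mass at the action `a₀`. -/
def pointMass (a₀ a : A) : ℝ := if a = a₀ then 1 else 0

open Classical in
/-- The law of the action at step `h` of episode `t`, given the past: it is drawn from
`π_t(· ∣ s_h, h)`, unless the algorithm has already terminated, when it is `aStar`. -/
def actionLaw (c : Params) (aStar : A) (X : Run S A Ω H) (t : ℕ) (h : Fin H) (ω : Ω) (b : A) : ℝ :=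
  if StoppedBefore c X t h ω then pointMass aStar b else X.pol t ω (X.st t h.castSucc ω) h b

variable [MeasurableSpace S] [MeasurableSpace A]

/-- `𝓕_t`: the σ-algebra of events up to the beginning of episode `t`, generated by the reward and
consumption functions of the episodes up to `t` and by the trajectories before `t`. -/
def episodeHist (X : Run S A Ω H) (t : ℕ) : MeasurableSpace Ω :=
  (⨆ j : ℕ, ⨆ _ : j ≤ t,
      MeasurableSpace.comap (X.f j) inferInstance ⊔ MeasurableSpace.comap (X.g j) inferInstance) ⊔
    (⨆ j : ℕ, ⨆ _ : j < t,
      (⨆ k : Fin (H + 1), MeasurableSpace.comap (X.st j k) inferInstance) ⊔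
        ⨆ k : Fin H, MeasurableSpace.comap (X.act j k) inferInstance)

/-- Information available when the action of step `h` of episode `t` is drawn. -/
def stateHist (X : Run S A Ω H) (t : ℕ) (h : Fin H) : MeasurableSpace Ω :=
  episodeHist X t ⊔
    (⨆ k : Fin (H + 1), ⨆ _ : k ≤ h.castSucc, MeasurableSpace.comap (X.st t k) inferInstance) ⊔
    (⨆ k : Fin H, ⨆ _ : k < h, MeasurableSpace.comap (X.act t k) inferInstance)

/-- Information available when the state following step `h` of episode `t` is drawn. -/
def actionHist (X : Run S A Ω H) (t : ℕ) (h : Fin H) : MeasurableSpace Ω :=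
  stateHist X t h ⊔ MeasurableSpace.comap (X.act t h) inferInstance

/-- `X` is a run, on the probability space `(Ω, μ)`, of the online dual mirror descent algorithm
in the MDP `M`, with default action `aStar`. -/
structure IsAlgorithmRun [MeasurableSpace Ω] (μ : Measure Ω) (M : MDP S A H) (c : Params)
    (aStar : A) (X : Run S A Ω H) : Prop where
  meas_f : ∀ t, Measurable (X.f t)
  meas_g : ∀ t, Measurable (X.g t)
  meas_st : ∀ t h, Measurable (X.st t h)
  meas_act : ∀ t h, Measurable (X.act t h)
  /-- rewards and consumptions lie in `[0,1]` -/
  f_mem : ∀ t < c.T, ∀ ω s a h, X.f t ω s a h ∈ Set.Icc (0 : ℝ) 1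
  g_mem : ∀ t < c.T, ∀ ω s a h, X.g t ω s a h ∈ Set.Icc (0 : ℝ) 1
  /-- the default action yields no reward and consumes nothing -/
  f_default : ∀ t < c.T, ∀ ω s h, X.f t ω s aStar h = 0
  g_default : ∀ t < c.T, ∀ ω s h, X.g t ω s aStar h = 0
  /-- `π_t` is a policy that is prepared from the information at the beginning of episode `t` -/
  pol_isPolicy : ∀ t < c.T, ∀ ω, IsPolicy (X.pol t ω)
  pol_meas : ∀ t < c.T, Measurable[episodeHist X t] (X.pol t)
  /-- policy update: `qhat t` maximizes the penalized reward over `Δ(P,t)` and induces `π_t` -/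
  qhat_argmax : ∀ t < c.T, ∀ ω, ¬ StoppedBy c X t ω →
    X.qhat t ω ∈ feasible c X t ω ∧
      IsMaxOn (fun q => dot (X.f t ω) q - X.lam t ω * dot (X.g t ω) q)
        (feasible c X t ω) (X.qhat t ω)
  pol_induced : ∀ t < c.T, ∀ ω, ¬ StoppedBy c X t ω → Induces (X.qhat t ω) (X.pol t ω)
  /-- after termination the policy is the default action -/
  pol_stopped : ∀ t < c.T, ∀ ω, StoppedBy c X t ω → ∀ s h a, X.pol t ω s h a = pointMass aStar a
  /-- dual update -/
  lam_init : ∀ ω, X.lam 0 ω = c.lam₀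
  lam_update : ∀ t, t + 1 < c.T → ∀ ω, ¬ StoppedBy c X (t + 1) ω →
    0 ≤ X.lam (t + 1) ω ∧
      IsMinOn (fun l => c.η * ((H : ℝ) * c.ρ - dot (X.g t ω) (X.qhat t ω)) * l
          + bregman c.ψ l (X.lam t ω))
        (Set.Ici 0) (X.lam (t + 1) ω)
  /-- policy execution: the first state has law `p`, … -/
  law_init : ∀ t < c.T, ∀ x : S,
    μ⟦X.st t 0 ⁻¹' {x} | episodeHist X t⟧ =ᵐ[μ] fun _ => M.p x
  /-- … actions are drawn from the policy until termination, … -/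
  law_act : ∀ t < c.T, ∀ (h : Fin H) (b : A),
    μ⟦X.act t h ⁻¹' {b} | stateHist X t h⟧ =ᵐ[μ] fun ω => actionLaw c aStar X t h ω b
  /-- … and states move according to the true kernel. -/
  law_trans : ∀ t < c.T, ∀ (h : Fin H) (y : S),
    μ⟦X.st t h.succ ⁻¹' {y} | actionHist X t h⟧ =ᵐ[μ]
      fun ω => M.P (X.st t h.castSucc ω) (X.act t h ω) h y

end Algorithm

/-- The expected reward `∑_t ⟨f_t, q_t⟩` with `q_t = q^{P,π_t}`. -/
def expectedReward {S A Ω : Type*} [Fintype S] [Fintype A] {H : ℕ}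
    (M : MDP S A H) (c : Params) (X : Run S A Ω H) (ω : Ω) : ℝ :=
  ∑ t ∈ Finset.range c.T, dot (occ M (X.pol t ω)) (X.f t ω)

/-- The realized reward `∑_t ∑_h f_t(s_h, a_h, h)`. -/
def realizedReward {S A Ω : Type*} {H : ℕ} (c : Params) (X : Run S A Ω H) (ω : Ω) : ℝ :=
  ∑ t ∈ Finset.range c.T, ∑ h : Fin H, X.f t ω (X.st t h.castSucc ω) (X.act t h ω) h

end EpisodicMDP

end

/-! Let `V` be the value function of `π_t` for the reward `f_t`. Realized minus expected reward of
an episode telescopes into `V₁(s₁) - ∑ p V₁` plus the temporal differences `f_t(s_h, a_h, h) +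
V_{h+1}(s_{h+1}) - V_h(s_h)`, each of conditional mean zero as long as actions are drawn from `π_t`.

Termination may fall inside an episode, so the temporal differences are dropped from then on
(`stepDiff`). The sum `episodeDiff` of what remains is still orthogonal to the past
(`integral_mul_episodeDiff`). Together with `∑ p V₁` it equals the reward up to termination plus the
value of the state reached there, hence lies in `[0, H]`; so `episodeDiff` is at most `H` in
absolute value (`abs_episodeDiff_le`). The true gap differs from it only in the terminating episode,
by at most `H`, because later rewards vanish almost surely (`sum_abs_gap_sub_diff_le`, `ae_act_eq`).

Azuma–Hoeffding over the `T` episodes then gives a deviation of order `H √(T ln(1/δ))` with failure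
probability `2δ`. Treating whole episodes as increments matters: `TH` single steps, each bounded
only by order `H`, would cost another factor `√H`. The term `H² S √A` of the bound is slack. -/

namespace EpisodicMDP

/-! ### Value functions and sums over trajectories -/

section Trajectories

variable {S A : Type*} [Fintype S] [Fintype A]

/-- Sums over tuples split into the head and the tail. -/
lemma sum_fin_cons {X : Type*} [Fintype X] {n : ℕ} (F : (Fin (n + 1) → X) → ℝ) :
    ∑ x, F x = ∑ x₀, ∑ x' : Fin n → X, F (Fin.cons x₀ x') := by
  rw [← (Fin.consEquiv fun _ : Fin (n + 1) => X).sum_comp F, Fintype.sum_prod_type]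
  rfl

/-- Total mass of the trajectories of a Markov chain with initial weights `q`. -/
lemma sum_traj_mass (n : ℕ) (q : S → ℝ) (w : Fin n → S → A → S → ℝ)
    (hw : ∀ h s, ∑ a, ∑ s', w h s a s' = 1) :
    ∑ x : Fin (n + 1) → S, ∑ b : Fin n → A,
      q (x 0) * ∏ h : Fin n, w h (x h.castSucc) (b h) (x h.succ) = ∑ s, q s := by
  induction n generalizing q with
  | zero =>
    rw [sum_fin_cons]
    simp
  | succ n ih =>
    rw [sum_fin_cons]
    refine Finset.sum_congr rfl fun s _ => ?_
    -- Given the first state and action, the rest is a chain with initial weights `w 0 s a`; these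
    -- need not sum to one, hence the induction over arbitrary `q`.
    have key : ∀ a, ∑ x' : Fin (n + 1) → S, ∑ b' : Fin n → A,
        w 0 s a (x' 0) * ∏ h : Fin n, w h.succ (x' h.castSucc) (b' h) (x' h.succ)
          = ∑ s', w 0 s a s' := fun a =>
      ih (w 0 s a) (fun h => w h.succ) fun h => hw h.succ
    have h1 := hw 0 s
    simp_rw [← key] at h1
    rw [Finset.sum_comm] at h1
    rw [← mul_one (q s), ← h1, Finset.mul_sum]
    refine Finset.sum_congr rfl fun x' _ => ?_
    rw [sum_fin_cons, Finset.mul_sum]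
    refine Finset.sum_congr rfl fun a _ => ?_
    rw [Finset.mul_sum]
    refine Finset.sum_congr rfl fun b' _ => ?_
    rw [Fin.prod_univ_succ]
    simp

/-- The expected total reward of a Markov chain is given by any solution of the backward
recursion. -/
lemma sum_traj_reward (n : ℕ) (q : S → ℝ) (w : Fin n → S → A → S → ℝ)
    (hw : ∀ h s, ∑ a, ∑ s', w h s a s' = 1) (r : Fin n → S → A → ℝ) (V : Fin (n + 1) → S → ℝ)
    (hlast : ∀ s, V (Fin.last n) s = 0)
    (hV : ∀ h s, V h.castSucc s = ∑ a, ∑ s', w h s a s' * (r h s a + V h.succ s')) :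
    ∑ x : Fin (n + 1) → S, ∑ b : Fin n → A,
      (q (x 0) * ∏ h : Fin n, w h (x h.castSucc) (b h) (x h.succ)) *
        ∑ h : Fin n, r h (x h.castSucc) (b h) = ∑ s, q s * V 0 s := by
  induction n generalizing q with
  | zero =>
    have : ∀ s, V 0 s = 0 := hlast
    simp [this]
  | succ n ih =>
    rw [sum_fin_cons]
    refine Finset.sum_congr rfl fun s _ => ?_
    have key : ∀ a, ∑ x' : Fin (n + 1) → S, ∑ b' : Fin n → A,
        (w 0 s a (x' 0) * ∏ h : Fin n, w h.succ (x' h.castSucc) (b' h) (x' h.succ)) *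
          (r 0 s a + ∑ h : Fin n, r h.succ (x' h.castSucc) (b' h))
          = ∑ s', w 0 s a s' * (r 0 s a + V (Fin.succ 0) s') := by
      intro a
      simp_rw [mul_add, Finset.sum_add_distrib, ← Finset.sum_mul]
      rw [sum_traj_mass n (w 0 s a) (fun h => w h.succ) fun h => hw h.succ]
      congr 1
      exact ih (w 0 s a) (fun h => w h.succ) (fun h => hw h.succ) (fun h => r h.succ)
        (fun h => V h.succ) hlast fun h s => by
          rw [Fin.succ_castSucc]
          exact hV h.succ s
    have h1 := hV 0 s
    simp_rw [← key] at h1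
    rw [Fin.castSucc_zero, Finset.sum_comm] at h1
    rw [h1, Finset.mul_sum]
    refine Finset.sum_congr rfl fun x' _ => ?_
    rw [sum_fin_cons, Finset.mul_sum]
    refine Finset.sum_congr rfl fun a _ => ?_
    rw [Finset.mul_sum]
    refine Finset.sum_congr rfl fun b' _ => ?_
    rw [Fin.prod_univ_succ, Fin.sum_univ_succ]
    simp [mul_assoc]

variable {H : ℕ}

/-- The value function of the policy `π` for the reward `f`: expected reward collected from a given
step on. -/
noncomputable def value (M : MDP S A H) (π : Pol S A H) (f : SAH S A H) : Fin (H + 1) → S → ℝ :=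
  Fin.reverseInduction (motive := fun _ => S → ℝ) (fun _ => 0)
    fun h v s => ∑ a, π s h a * (f s a h + ∑ s', M.P s a h s' * v s')

lemma value_last (M : MDP S A H) (π : Pol S A H) (f : SAH S A H) (s : S) :
    value M π f (Fin.last H) s = 0 := by
  simp [value]

lemma value_castSucc (M : MDP S A H) (π : Pol S A H) (f : SAH S A H) (h : Fin H) (s : S) :
    value M π f h.castSucc s =
      ∑ a, π s h a * (f s a h + ∑ s', M.P s a h s' * value M π f h.succ s') := by
  simp [value]

/-- Exchanging sums collapses the indicators in `occ`, leaving the expected total reward over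
trajectories, which the Bellman recursion evaluates. -/
lemma dot_occ (M : MDP S A H) (π : Pol S A H) (f : SAH S A H) (hπ : IsPolicy π) :
    dot (occ M π) f = ∑ s, M.p s * value M π f 0 s := by
  classical
  have h2 : ∀ h s, ∑ a, ∑ s', π s h a * M.P s a h s' = 1 := fun h s => by
    simp_rw [← Finset.mul_sum, (M.P_isKernel s _ h).2, mul_one, (hπ s h).2]
  rw [← sum_traj_reward H M.p (fun h s a s' => π s h a * M.P s a h s') h2
    (fun h s a => f s a h) (value M π f) (value_last M π f)]
  · have h3 : ∀ s a h, occ M π s a h * f s a h = ∑ x : Fin (H + 1) → S, ∑ b : Fin H → A,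
        if x h.castSucc = s ∧ b h = a then trajProb M π x b * f s a h else 0 := by
      intro s a h
      simp_rw [occ, Finset.sum_mul, ite_mul, zero_mul]
    have h4 : ∀ (x : Fin (H + 1) → S) (b : Fin H → A) (h : Fin H),
        ∑ s, ∑ a, (if x h.castSucc = s ∧ b h = a then trajProb M π x b * f s a h else 0)
          = trajProb M π x b * f (x h.castSucc) (b h) h := by
      intro x b h
      simp_rw [ite_and]
      simp
    calc dot (occ M π) f
        = ∑ s, ∑ a, ∑ h, ∑ x : Fin (H + 1) → S, ∑ b : Fin H → A,
          (if x h.castSucc = s ∧ b h = a then trajProb M π x b * f s a h else 0) := by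
          simp_rw [dot, h3]
      _ = ∑ h, ∑ x : Fin (H + 1) → S, ∑ b : Fin H → A, ∑ s, ∑ a,
          (if x h.castSucc = s ∧ b h = a then trajProb M π x b * f s a h else 0) := by
          simp_rw [Finset.sum_comm (s := (Finset.univ : Finset A)) (t := (Finset.univ : Finset (Fin H)))]
          rw [Finset.sum_comm]
          refine Finset.sum_congr rfl fun h _ => ?_
          simp_rw [Finset.sum_comm (s := (Finset.univ : Finset A))
            (t := (Finset.univ : Finset (Fin (H + 1) → S)))]
          rw [Finset.sum_comm]
          refine Finset.sum_congr rfl fun x _ => ?_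
          simp_rw [Finset.sum_comm (s := (Finset.univ : Finset A))
            (t := (Finset.univ : Finset (Fin H → A)))]
          rw [Finset.sum_comm]
      _ = _ := by
          simp_rw [h4]
          rw [Finset.sum_comm]
          refine Finset.sum_congr rfl fun x _ => ?_
          rw [Finset.sum_comm]
          refine Finset.sum_congr rfl fun b _ => ?_
          rw [← Finset.mul_sum]
          rfl
  · intro h s
    rw [value_castSucc]
    refine Finset.sum_congr rfl fun a _ => ?_
    simp_rw [mul_add, Finset.sum_add_distrib, ← Finset.sum_mul, ← Finset.mul_sum,
      (M.P_isKernel s a h).2, mul_one, mul_assoc, ← Finset.mul_sum]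

lemma sum_mem_Icc_of_isProbVec {X : Type*} [Fintype X] {v : X → ℝ} (hv : IsProbVec v)
    {F : X → ℝ} {B : ℝ} (hF : ∀ x, F x ∈ Set.Icc 0 B) : ∑ x, v x * F x ∈ Set.Icc 0 B := by
  refine ⟨Finset.sum_nonneg fun x _ => mul_nonneg (hv.1 x) (hF x).1, ?_⟩
  calc ∑ x, v x * F x ≤ ∑ x, v x * B :=
        Finset.sum_le_sum fun x _ => mul_le_mul_of_nonneg_left (hF x).2 (hv.1 x)
    _ = B := by rw [← Finset.sum_mul, hv.2, one_mul]

/-- Each remaining step contributes at most one. -/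
lemma value_mem_Icc (M : MDP S A H) {π : Pol S A H} {f : SAH S A H} (hπ : IsPolicy π)
    (hf : ∀ s a h, f s a h ∈ Set.Icc (0 : ℝ) 1) (h : Fin (H + 1)) (s : S) :
    value M π f h s ∈ Set.Icc 0 ((H : ℝ) - (h : ℕ)) := by
  induction h using Fin.reverseInduction generalizing s with
  | last => simp [value_last]
  | cast h ih =>
    rw [value_castSucc]
    refine sum_mem_Icc_of_isProbVec (hπ s h) fun a => ?_
    have h1 := sum_mem_Icc_of_isProbVec (M.P_isKernel s a h) ih
    have h2 := hf s a h
    simp only [Set.mem_Icc, Fin.val_succ, Fin.val_castSucc, Nat.cast_add, Nat.cast_one] at *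
    constructor <;> linarith

lemma value_eq_zero (M : MDP S A H) {π : Pol S A H} {f : SAH S A H} {aStar : A}
    (hπ : ∀ s h a, π s h a = pointMass aStar a) (hf : ∀ s h, f s aStar h = 0)
    (h : Fin (H + 1)) (s : S) : value M π f h s = 0 := by
  classical
  induction h using Fin.reverseInduction generalizing s with
  | last => simp [value_last]
  | cast h ih => simp [value_castSucc, hπ, pointMass, ih, hf]

/-- A value process stopped at an antitone family of events stays in `[0, n]`. -/
lemma stopped_sum_mem_Icc {n : ℕ} (v : Fin (n + 1) → ℝ) (f : Fin n → ℝ) (e : Fin n → Prop)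
    [DecidablePred e] (hv : ∀ i : Fin (n + 1), v i ∈ Set.Icc 0 ((n : ℝ) - (i : ℕ)))
    (hf : ∀ i, f i ∈ Set.Icc (0 : ℝ) 1) (he : ∀ i j, i ≤ j → e j → e i) :
    v 0 + ∑ i, (if e i then f i + v i.succ - v i.castSucc else 0) ∈ Set.Icc (0 : ℝ) n := by
  induction n with
  | zero => simpa using hv 0
  | succ n ih =>
    rw [Fin.sum_univ_succ]
    -- If the first step counts, `v 0` cancels and `f 0 ≤ 1` is added to the tail, which is at most
    -- `n`; otherwise no step counts and only `v 0` is left.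
    by_cases h0 : e 0
    · have h1 := ih (fun i => v i.succ) (fun i => f i.succ) (fun i => e i.succ)
        (fun i => by simpa using hv i.succ) (fun i => hf i.succ)
        fun i j hij => he _ _ (Fin.succ_le_succ_iff.2 hij)
      have h2 := hf 0
      simp only [h0, if_true, Set.mem_Icc, Fin.castSucc_zero, Fin.succ_castSucc, Nat.cast_add,
        Nat.cast_one] at *
      constructor <;> linarith
    · have h1 : ∀ i, ¬ e i := fun i hi => h0 (he 0 i (Fin.zero_le i) hi)
      simpa [h1] using hv 0

lemma telescope_sum {n : ℕ} (v : Fin (n + 1) → ℝ) (f : Fin n → ℝ) :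
    v 0 + ∑ i : Fin n, (f i + v i.succ - v i.castSucc) = v (Fin.last n) + ∑ i, f i := by
  induction n with
  | zero => simp
  | succ n ih =>
    have h1 := ih (fun i => v i.succ) fun i => f i.succ
    rw [Fin.sum_univ_succ, Fin.sum_univ_succ]
    simp only [Fin.succ_castSucc, Fin.castSucc_zero, Fin.succ_last] at *
    linarith

end Trajectories

/-! ### Integrals against a conditional law -/

section Sampling

variable {Ω : Type*} {m m0 : MeasurableSpace Ω} {μ : @Measure Ω m0} [IsProbabilityMeasure μ]

/-- Pulling `W` out of the conditional expectation. Integrability of `W * κ` is recorded too,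
because `κ` is a version known only almost everywhere and carries no bound of its own. -/
lemma integral_mul_of_condProb (hm : m ≤ m0) {E : Set Ω} (hE : MeasurableSet[m0] E) {κ : Ω → ℝ}
    (hκ : μ⟦E|m⟧ =ᵐ[μ] κ) {W : Ω → ℝ} (hW : Measurable[m] W) {B : ℝ} (hB : ∀ ω, |W ω| ≤ B) :
    Integrable (fun ω => W ω * κ ω) μ ∧
      ∫ ω, W ω * E.indicator (fun _ => (1 : ℝ)) ω ∂μ = ∫ ω, W ω * κ ω ∂μ := by
  have hW0 : AEStronglyMeasurable W μ := (hW.mono hm le_rfl).aestronglyMeasurable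
  have hi : Integrable (E.indicator fun _ => (1 : ℝ)) μ := (integrable_const _).indicator hE
  have hWi : Integrable (W * E.indicator fun _ => (1 : ℝ)) μ :=
    hi.bdd_mul (c := B) hW0 (Filter.Eventually.of_forall hB)
  have hpull := condExp_mul_of_stronglyMeasurable_left (m := m) (μ := μ) hW.stronglyMeasurable
    hWi hi
  have hae : (fun ω => W ω * κ ω) =ᵐ[μ] μ[W * E.indicator (fun _ => (1 : ℝ))|m] := by
    filter_upwards [hκ, hpull] with ω h1 h2
    rw [h2, Pi.mul_apply, h1]
  refine ⟨integrable_condExp.congr hae.symm, ?_⟩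
  rw [integral_congr_ae hae, integral_condExp hm]
  rfl

/-- Splits over the finitely many values of `y`. Every sampling law of the algorithm enters the
proof through this identity. -/
lemma integral_comp_of_condLaw {Y : Type*} [Fintype Y] [MeasurableSpace Y]
    [DiscreteMeasurableSpace Y] (hm : m ≤ m0) {y : Ω → Y} (hy : Measurable[m0] y) {κ : Y → Ω → ℝ}
    (hκ : ∀ i, μ⟦y ⁻¹' {i}|m⟧ =ᵐ[μ] κ i) {φ : Y → Ω → ℝ} (hφ : ∀ i, Measurable[m] (φ i))
    {B : ℝ} (hB : ∀ i ω, |φ i ω| ≤ B) :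
    ∫ ω, φ (y ω) ω ∂μ = ∫ ω, ∑ i, φ i ω * κ i ω ∂μ := by
  classical
  have hE : ∀ i, MeasurableSet[m0] (y ⁻¹' {i}) := fun i => hy (MeasurableSet.of_discrete)
  have key := fun i => integral_mul_of_condProb hm (hE i) (hκ i) (hφ i) (hB i)
  have h1 : ∀ ω, φ (y ω) ω = ∑ i, φ i ω * (y ⁻¹' {i}).indicator (fun _ => (1 : ℝ)) ω := by
    intro ω
    simp [Set.indicator_apply]
  simp_rw [h1]
  rw [integral_finsetSum, integral_finsetSum]
  · exact Finset.sum_congr rfl fun i _ => (key i).2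
  · exact fun i _ => (key i).1
  · intro i _
    exact ((integrable_const (1 : ℝ)).indicator (hE i)).bdd_mul (c := B)
      ((hφ i).mono hm le_rfl).aestronglyMeasurable (Filter.Eventually.of_forall (hB i))

lemma measurable_eval_discrete {Y : Type*} [Finite Y] [MeasurableSpace Y]
    [DiscreteMeasurableSpace Y] {Ω : Type*} {m : MeasurableSpace Ω} {φ : Y → Ω → ℝ}
    (hφ : ∀ i, Measurable (φ i)) {y : Ω → Y} (hy : Measurable y) :
    Measurable fun ω => φ (y ω) ω := by
  have h : Measurable fun z : Y × Ω => φ z.1 z.2 := measurable_from_prod_countable_right hφ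
  exact h.comp (hy.prodMk measurable_id)

end Sampling

/-! ### Measurability -/

section Measurability

variable {S A Ω : Type*} [Fintype S] [Fintype A] {H : ℕ}
  [MeasurableSpace S] [DiscreteMeasurableSpace S] [MeasurableSpace A] [DiscreteMeasurableSpace A]

omit [Fintype S] [Fintype A] [MeasurableSpace S] [DiscreteMeasurableSpace S] [MeasurableSpace A]
  [DiscreteMeasurableSpace A] in
lemma measurable_apply_sah {m : MeasurableSpace Ω} {F : Ω → SAH S A H} (hF : Measurable F)
    (s : S) (a : A) (h : Fin H) : Measurable fun ω => F ω s a h :=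
  (measurable_pi_apply h).comp ((measurable_pi_apply a).comp ((measurable_pi_apply s).comp hF))

lemma measurable_eval_sah {m : MeasurableSpace Ω} {F : Ω → SAH S A H} (hF : Measurable F)
    {s : Ω → S} {a : Ω → A} (hs : Measurable s) (ha : Measurable a) (h : Fin H) :
    Measurable fun ω => F ω (s ω) (a ω) h :=
  measurable_eval_discrete (φ := fun i ω => F ω i (a ω) h)
    (fun i => measurable_eval_discrete (φ := fun j ω => F ω i j h)
      (fun j => measurable_apply_sah hF i j h) ha) hs

omit [MeasurableSpace S] [DiscreteMeasurableSpace S] [MeasurableSpace A]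
  [DiscreteMeasurableSpace A] in
lemma measurable_value {m : MeasurableSpace Ω} (M : MDP S A H) {π : Ω → Pol S A H}
    {f : Ω → SAH S A H} (hπ : Measurable π) (hf : Measurable f) (h : Fin (H + 1)) (s : S) :
    Measurable fun ω => value M (π ω) (f ω) h s := by
  induction h using Fin.reverseInduction generalizing s with
  | last => simp [value_last]
  | cast h ih =>
    simp_rw [value_castSucc]
    refine Finset.measurable_sum _ fun a _ => Measurable.mul ?_ (Measurable.add ?_ ?_)
    · exact (measurable_pi_apply a).comp
        ((measurable_pi_apply h).comp ((measurable_pi_apply s).comp hπ))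
    · exact measurable_apply_sah hf s a h
    · exact Finset.measurable_sum _ fun s' _ => (ih s').const_mul _

/-- The σ-algebra is left open, so that the same proof serves `episodeHist` and the finer
`stateHist`. -/
lemma measurable_remaining {m : MeasurableSpace Ω} (c : Params) (X : Run S A Ω H) (t : ℕ)
    (h : Fin H) (hg : ∀ j ≤ t, Measurable (X.g j)) (hst : ∀ j < t, ∀ k, Measurable (X.st j k))
    (hact : ∀ j < t, ∀ k, Measurable (X.act j k))
    (hst' : ∀ k ≤ h, Measurable (X.st t k.castSucc)) (hact' : ∀ k ≤ h, Measurable (X.act t k)) :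
    Measurable (remaining c X t h) := by
  refine (measurable_const.sub (Finset.measurable_sum _ fun j hj => ?_)).sub
    (Finset.measurable_sum _ fun k hk => ?_)
  · have hj' := Finset.mem_range.1 hj
    exact Finset.measurable_sum _ fun k _ =>
      measurable_eval_sah (hg j hj'.le) (hst j hj' _) (hact j hj' _) k
  · have hk' := Finset.mem_Iic.1 hk
    exact measurable_eval_sah (hg t le_rfl) (hst' k hk') (hact' k hk') k

/-! ### The filtration of the run. -/

section Histories

variable (X : Run S A Ω H)

omit [Fintype S] [Fintype A] [DiscreteMeasurableSpace S] [DiscreteMeasurableSpace A]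

lemma measurable_f_episodeHist {j t : ℕ} (hj : j ≤ t) : Measurable[episodeHist X t] (X.f j) :=
  Measurable.of_comap_le <| le_sup_of_le_left <| le_iSup₂_of_le j hj le_sup_left

lemma measurable_g_episodeHist {j t : ℕ} (hj : j ≤ t) : Measurable[episodeHist X t] (X.g j) :=
  Measurable.of_comap_le <| le_sup_of_le_left <| le_iSup₂_of_le j hj le_sup_right

lemma measurable_st_episodeHist {j t : ℕ} (hj : j < t) (k : Fin (H + 1)) :
    Measurable[episodeHist X t] (X.st j k) :=
  Measurable.of_comap_le <| le_sup_of_le_right <| le_iSup₂_of_le j hj <| le_sup_of_le_left <|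
    le_iSup_of_le k le_rfl

lemma measurable_act_episodeHist {j t : ℕ} (hj : j < t) (k : Fin H) :
    Measurable[episodeHist X t] (X.act j k) :=
  Measurable.of_comap_le <| le_sup_of_le_right <| le_iSup₂_of_le j hj <| le_sup_of_le_right <|
    le_iSup_of_le k le_rfl

lemma episodeHist_le_stateHist (t : ℕ) (h : Fin H) : episodeHist X t ≤ stateHist X t h :=
  le_sup_of_le_left le_sup_left

lemma measurable_st_stateHist (t : ℕ) {h : Fin H} {k : Fin (H + 1)} (hk : k ≤ h.castSucc) :
    Measurable[stateHist X t h] (X.st t k) :=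
  Measurable.of_comap_le <| le_sup_of_le_left <| le_sup_of_le_right <|
    le_iSup₂_of_le k hk le_rfl

lemma measurable_act_stateHist (t : ℕ) {h k : Fin H} (hk : k < h) :
    Measurable[stateHist X t h] (X.act t k) :=
  Measurable.of_comap_le <| le_sup_of_le_right <| le_iSup₂_of_le k hk le_rfl

lemma stateHist_le_actionHist (t : ℕ) (h : Fin H) : stateHist X t h ≤ actionHist X t h :=
  le_sup_left

lemma measurable_act_actionHist (t : ℕ) (h : Fin H) : Measurable[actionHist X t h] (X.act t h) :=
  Measurable.of_comap_le le_sup_right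

/-- With `m` arbitrary this yields both monotonicity in `t` and inclusion in the ambient σ-algebra.
-/
lemma episodeHist_le {m : MeasurableSpace Ω} {t : ℕ} (hf : ∀ j ≤ t, Measurable (X.f j))
    (hg : ∀ j ≤ t, Measurable (X.g j)) (hst : ∀ j < t, ∀ k, Measurable (X.st j k))
    (hact : ∀ j < t, ∀ k, Measurable (X.act j k)) : episodeHist X t ≤ m :=
  sup_le (iSup₂_le fun j hj => sup_le (hf j hj).comap_le (hg j hj).comap_le)
    (iSup₂_le fun j hj => sup_le (iSup_le fun k => (hst j hj k).comap_le)
      (iSup_le fun k => (hact j hj k).comap_le))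

lemma actionHist_le {m : MeasurableSpace Ω} {t : ℕ} (h : Fin H) (hE : episodeHist X t ≤ m)
    (hst : ∀ k, Measurable (X.st t k)) (hact : ∀ k, Measurable (X.act t k)) :
    actionHist X t h ≤ m :=
  sup_le (sup_le (sup_le hE (iSup₂_le fun k _ => (hst k).comap_le))
    (iSup₂_le fun k _ => (hact k).comap_le)) (hact h).comap_le

lemma episodeHist_mono {t u : ℕ} (htu : t ≤ u) : episodeHist X t ≤ episodeHist X u :=
  episodeHist_le X (fun _ hj => measurable_f_episodeHist X (hj.trans htu))
    (fun _ hj => measurable_g_episodeHist X (hj.trans htu))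
    (fun _ hj => measurable_st_episodeHist X (hj.trans_le htu))
    (fun _ hj => measurable_act_episodeHist X (hj.trans_le htu))

lemma actionHist_le_episodeHist (t : ℕ) (h : Fin H) : actionHist X t h ≤ episodeHist X (t + 1) :=
  actionHist_le X h (episodeHist_mono X t.le_succ)
    (measurable_st_episodeHist X t.lt_succ_self) (measurable_act_episodeHist X t.lt_succ_self)

end Histories

lemma measurableSet_stoppedBy (c : Params) (X : Run S A Ω H) (t : ℕ) :
    MeasurableSet[episodeHist X t] {ω | StoppedBy c X t ω} := by
  have h : {ω | StoppedBy c X t ω} = ⋃ j, ⋃ _ : j < t, ⋃ k, {ω | remaining c X j k ω < 1} := by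
    ext ω
    simp [StoppedBy]
  rw [h]
  refine MeasurableSet.iUnion fun j => MeasurableSet.iUnion fun hj => MeasurableSet.iUnion fun k =>
    measurableSet_lt (measurable_remaining c X j k ?_ ?_ ?_ ?_ ?_) measurable_const
  · exact fun i hi => measurable_g_episodeHist X (hi.trans hj.le)
  · exact fun i hi => measurable_st_episodeHist X (hi.trans hj)
  · exact fun i hi => measurable_act_episodeHist X (hi.trans hj)
  · exact fun i _ => measurable_st_episodeHist X hj _
  · exact fun i _ => measurable_act_episodeHist X hj _

/-- Whether a step is still counted is decided before its action is drawn, so dropping the later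
differences keeps the mean zero. -/
lemma measurableSet_stoppedBefore (c : Params) (X : Run S A Ω H) (t : ℕ) (h : Fin H) :
    MeasurableSet[stateHist X t h] {ω | StoppedBefore c X t h ω} := by
  have hE := episodeHist_le_stateHist X t h
  have h' : {ω | StoppedBefore c X t h ω} =
      {ω | StoppedBy c X t ω} ∪ ⋃ k, ⋃ _ : k < h, {ω | remaining c X t k ω < 1} := by
    ext ω
    simp [StoppedBefore]
  rw [h']
  refine (hE _ (measurableSet_stoppedBy c X t)).union <| MeasurableSet.iUnion fun k =>
    MeasurableSet.iUnion fun hk =>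
      measurableSet_lt (measurable_remaining c X t k ?_ ?_ ?_ ?_ ?_) measurable_const
  · exact fun i hi => (measurable_g_episodeHist X hi).mono hE le_rfl
  · exact fun i hi k => (measurable_st_episodeHist X hi k).mono hE le_rfl
  · exact fun i hi k => (measurable_act_episodeHist X hi k).mono hE le_rfl
  · exact fun i hi => measurable_st_stateHist X t (Fin.castSucc_le_castSucc_iff.2 (hi.trans hk.le))
  · exact fun i hi => measurable_act_stateHist X t (hi.trans_lt hk)

end Measurability

/-! ### The martingale differences of an episode -/

section Martingale

variable {S A Ω : Type*} [Fintype S] [Fintype A] {H : ℕ}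

open Classical in
/-- Deviation of the first state from its law, in terms of the value function of the episode. -/
noncomputable def initDiff (M : MDP S A H) (c : Params) (X : Run S A Ω H) (t : ℕ) (ω : Ω) : ℝ :=
  if StoppedBy c X t ω then 0 else
    value M (X.pol t ω) (X.f t ω) 0 (X.st t 0 ω) -
      ∑ s, M.p s * value M (X.pol t ω) (X.f t ω) 0 s

open Classical in
/-- Temporal difference of the value function at one step, as long as the algorithm runs. -/
noncomputable def stepDiff (M : MDP S A H) (c : Params) (X : Run S A Ω H) (t : ℕ) (h : Fin H)
    (ω : Ω) : ℝ :=
  if ¬ StoppedBefore c X t h ω then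
    X.f t ω (X.st t h.castSucc ω) (X.act t h ω) h
      + value M (X.pol t ω) (X.f t ω) h.succ (X.st t h.succ ω)
      - value M (X.pol t ω) (X.f t ω) h.castSucc (X.st t h.castSucc ω)
  else 0

/-- The martingale difference of an episode: realized minus expected reward, the episode being
completed by the value function if the algorithm terminates in its course. -/
noncomputable def episodeDiff (M : MDP S A H) (c : Params) (X : Run S A Ω H) (t : ℕ) (ω : Ω) : ℝ :=
  initDiff M c X t ω + ∑ h, stepDiff M c X t h ω

/-- The gap between realized and expected reward of an episode. -/
noncomputable def episodeGap (M : MDP S A H) (X : Run S A Ω H) (t : ℕ) (ω : Ω) : ℝ :=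
  (∑ h : Fin H, X.f t ω (X.st t h.castSucc ω) (X.act t h ω) h) - dot (occ M (X.pol t ω)) (X.f t ω)

omit [Fintype S] [Fintype A] in
lemma StoppedBy.mono {c : Params} {X : Run S A Ω H} {t u : ℕ} (htu : t ≤ u) {ω : Ω}
    (h : StoppedBy c X t ω) : StoppedBy c X u ω := by
  obtain ⟨j, hj, hk⟩ := h
  exact ⟨j, hj.trans_le htu, hk⟩

omit [Fintype S] [Fintype A] in
lemma StoppedBefore.mono {c : Params} {X : Run S A Ω H} {t : ℕ} {h k : Fin H} (hk : h ≤ k) {ω : Ω}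
    (hs : StoppedBefore c X t h ω) : StoppedBefore c X t k ω := by
  obtain hs | ⟨i, hi, hr⟩ := hs
  · exact Or.inl hs
  · exact Or.inr ⟨i, hi.trans_le hk, hr⟩

omit [Fintype S] [Fintype A] in
lemma StoppedBefore.stoppedBy_succ {c : Params} {X : Run S A Ω H} {t : ℕ} {h : Fin H} {ω : Ω}
    (hs : StoppedBefore c X t h ω) : StoppedBy c X (t + 1) ω := by
  obtain hs | ⟨i, _, hr⟩ := hs
  · exact hs.mono t.le_succ
  · exact ⟨t, t.lt_succ_self, i, hr⟩

variable [MeasurableSpace S] [DiscreteMeasurableSpace S] [MeasurableSpace A]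
  [DiscreteMeasurableSpace A] [MeasurableSpace Ω] {μ : Measure Ω}
  {M : MDP S A H} {c : Params} {aStar : A} {X : Run S A Ω H}

namespace IsAlgorithmRun

omit [DiscreteMeasurableSpace S] [DiscreteMeasurableSpace A] in
lemma episodeHist_le (hX : IsAlgorithmRun μ M c aStar X) (t : ℕ) :
    episodeHist X t ≤ ‹MeasurableSpace Ω› :=
  EpisodicMDP.episodeHist_le X (fun j _ => hX.meas_f j) (fun j _ => hX.meas_g j)
    (fun j _ => hX.meas_st j) fun j _ => hX.meas_act j

omit [DiscreteMeasurableSpace S] [DiscreteMeasurableSpace A] in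
lemma actionHist_le (hX : IsAlgorithmRun μ M c aStar X) (t : ℕ) (h : Fin H) :
    actionHist X t h ≤ ‹MeasurableSpace Ω› :=
  EpisodicMDP.actionHist_le X h (hX.episodeHist_le t) (hX.meas_st t) (hX.meas_act t)

omit [DiscreteMeasurableSpace S] [DiscreteMeasurableSpace A] in
lemma stopped_episodeSum_mem_Icc (hX : IsAlgorithmRun μ M c aStar X) {t : ℕ} (ht : t < c.T)
    (ω : Ω) : value M (X.pol t ω) (X.f t ω) 0 (X.st t 0 ω) + ∑ h, stepDiff M c X t h ω
      ∈ Set.Icc (0 : ℝ) H := by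
  classical
  convert stopped_sum_mem_Icc (fun h => value M (X.pol t ω) (X.f t ω) h (X.st t h ω))
    (fun h => X.f t ω (X.st t h.castSucc ω) (X.act t h ω) h) (fun h => ¬ StoppedBefore c X t h ω)
    (fun h => value_mem_Icc M (hX.pol_isPolicy t ht ω) (hX.f_mem t ht ω) h _)
    (fun h => hX.f_mem t ht ω _ _ h) fun i j hij hj hi => hj (hi.mono hij)
  unfold stepDiff
  congr

omit [DiscreteMeasurableSpace S] [DiscreteMeasurableSpace A] in
-- A difference of two numbers in `[0, H]`: the stopped sum and the mean initial value.
lemma abs_episodeDiff_le (hX : IsAlgorithmRun μ M c aStar X) {t : ℕ} (ht : t < c.T) (ω : Ω) :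
    |episodeDiff M c X t ω| ≤ H := by
  by_cases hs : StoppedBy c X t ω
  · have : ∀ h, StoppedBefore c X t h ω := fun h => Or.inl hs
    simp [episodeDiff, initDiff, stepDiff, hs, this]
  · have h1 := hX.stopped_episodeSum_mem_Icc ht ω
    have h2 := sum_mem_Icc_of_isProbVec M.p_isProbVec fun s =>
      value_mem_Icc M (hX.pol_isPolicy t ht ω) (hX.f_mem t ht ω) 0 s
    simp only [episodeDiff, initDiff, hs, if_false, Set.mem_Icc, Fin.val_zero, Nat.cast_zero,
      sub_zero] at *
    rw [abs_le]
    constructor <;> linarith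

omit [DiscreteMeasurableSpace S] [DiscreteMeasurableSpace A] in
/-- Until termination the gap of an episode is its martingale difference; after termination both
vanish; in the episode of termination they differ by at most `H`. -/
lemma sum_abs_gap_sub_diff_le (hX : IsAlgorithmRun μ M c aStar X) {ω : Ω}
    (hω : ∀ t < c.T, ∀ h, StoppedBefore c X t h ω → X.act t h ω = aStar) {n : ℕ} (hn : n ≤ c.T) :
    ∑ t ∈ Finset.range n, |episodeGap M X t ω - episodeDiff M c X t ω| ≤ H ∧
      (¬ StoppedBy c X n ω →
        ∑ t ∈ Finset.range n, |episodeGap M X t ω - episodeDiff M c X t ω| ≤ 0) := by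
  induction n with
  | zero => simp
  | succ n ih =>
    have hn' : n < c.T := hn
    obtain ⟨ih1, ih2⟩ := ih hn'.le
    rw [Finset.sum_range_succ]
    have hpol := hX.pol_isPolicy n hn' ω
    have hf := hX.f_mem n hn' ω
    by_cases hs : StoppedBy c X n ω
    · have h0 : episodeGap M X n ω - episodeDiff M c X n ω = 0 := by
        have h1 : ∀ h, StoppedBefore c X n h ω := fun h => Or.inl hs
        have h2 := fun h => hω n hn' h (h1 h)
        have h3 := value_eq_zero M (hX.pol_stopped n hn' ω hs) (hX.f_default n hn' ω)
        simp [episodeGap, episodeDiff, initDiff, stepDiff, hs, h1, dot_occ M _ _ hpol, h2, h3,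
          hX.f_default n hn' ω]
      rw [h0, abs_zero, add_zero]
      exact ⟨ih1, fun h => absurd (hs.mono n.le_succ) h⟩
    · have ih3 := ih2 hs
      have hgap : episodeGap M X n ω - episodeDiff M c X n ω =
          (∑ h : Fin H, X.f n ω (X.st n h.castSucc ω) (X.act n h ω) h) -
          (value M (X.pol n ω) (X.f n ω) 0 (X.st n 0 ω) + ∑ h, stepDiff M c X n h ω) := by
        simp only [episodeGap, episodeDiff, initDiff, hs, if_false, dot_occ M _ _ hpol]
        ring
      constructor
      -- Possibly the terminating episode: the gap is a difference of two numbers in `[0, H]`. By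
      -- `ih3` nothing has accumulated before, so this `H` is paid only once.
      · have h1 := hX.stopped_episodeSum_mem_Icc hn' ω
        have h2 : ∑ h : Fin H, X.f n ω (X.st n h.castSucc ω) (X.act n h ω) h ∈ Set.Icc (0 : ℝ) H := by
          refine ⟨Finset.sum_nonneg fun h _ => (hf _ _ h).1, ?_⟩
          exact (Finset.sum_le_sum fun h _ => (hf _ _ h).2).trans (by simp)
        have h3 : |episodeGap M X n ω - episodeDiff M c X n ω| ≤ H := by
          rw [hgap, abs_le]
          constructor <;> linarith [h1.1, h1.2, h2.1, h2.2]
        linarith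
      · intro hs'
        have h1 : ∀ h, ¬ StoppedBefore c X n h ω := fun h hh => hs' hh.stoppedBy_succ
        have h2 := telescope_sum (fun h => value M (X.pol n ω) (X.f n ω) h (X.st n h ω))
          fun h : Fin H => X.f n ω (X.st n h.castSucc ω) (X.act n h ω) h
        simp only [value_last, zero_add] at h2
        have h3 : episodeGap M X n ω - episodeDiff M c X n ω = 0 := by
          rw [hgap, ← h2]
          simp [stepDiff, h1]
        rw [h3, abs_zero, add_zero]
        exact ih3

omit [DiscreteMeasurableSpace S] [DiscreteMeasurableSpace A] in
lemma measurable_value (hX : IsAlgorithmRun μ M c aStar X) {t : ℕ} (ht : t < c.T)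
    (h : Fin (H + 1)) (s : S) :
    Measurable[episodeHist X t] fun ω => value M (X.pol t ω) (X.f t ω) h s :=
  EpisodicMDP.measurable_value M (hX.pol_meas t ht) (measurable_f_episodeHist X le_rfl) h s

omit [DiscreteMeasurableSpace A] in
lemma measurable_value_st (hX : IsAlgorithmRun μ M c aStar X) {t : ℕ} (ht : t < c.T)
    (h : Fin (H + 1)) : Measurable[episodeHist X (t + 1)]
      fun ω => value M (X.pol t ω) (X.f t ω) h (X.st t h ω) :=
  measurable_eval_discrete (φ := fun s ω => value M (X.pol t ω) (X.f t ω) h s)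
    (fun s => (hX.measurable_value ht h s).mono (episodeHist_mono X t.le_succ) le_rfl)
    (measurable_st_episodeHist X t.lt_succ_self h)

lemma measurable_initDiff (hX : IsAlgorithmRun μ M c aStar X) {t : ℕ} (ht : t < c.T) :
    Measurable[episodeHist X (t + 1)] (initDiff M c X t) := by
  have hle := episodeHist_mono X t.le_succ
  exact Measurable.ite (hle _ (measurableSet_stoppedBy c X t)) measurable_const
    ((hX.measurable_value_st ht 0).sub (Finset.measurable_sum _ fun s _ =>
      ((hX.measurable_value ht 0 s).mono hle le_rfl).const_mul _))

lemma measurable_stepDiff (hX : IsAlgorithmRun μ M c aStar X) {t : ℕ} (ht : t < c.T)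
    (h : Fin H) : Measurable[episodeHist X (t + 1)] (stepDiff M c X t h) := by
  have hle := (stateHist_le_actionHist X t h).trans (actionHist_le_episodeHist X t h)
  have hV := hX.measurable_value_st ht
  exact Measurable.ite (hle _ (measurableSet_stoppedBefore c X t h)).compl
    (((measurable_eval_sah (measurable_f_episodeHist X t.le_succ)
      (measurable_st_episodeHist X t.lt_succ_self _)
      (measurable_act_episodeHist X t.lt_succ_self _) h).add (hV _)).sub (hV _))
    measurable_const

lemma measurable_episodeDiff (hX : IsAlgorithmRun μ M c aStar X) {t : ℕ} (ht : t < c.T) :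
    Measurable[episodeHist X (t + 1)] (episodeDiff M c X t) :=
  (hX.measurable_initDiff ht).add (Finset.measurable_sum _ fun h _ => hX.measurable_stepDiff ht h)

omit [DiscreteMeasurableSpace S] [DiscreteMeasurableSpace A] in
-- A crude bound that serves integrability only.
lemma abs_stepDiff_le (hX : IsAlgorithmRun μ M c aStar X) {t : ℕ} (ht : t < c.T) (h : Fin H)
    (ω : Ω) : |stepDiff M c X t h ω| ≤ 1 + H := by
  have hr := hX.f_mem t ht ω (X.st t h.castSucc ω) (X.act t h ω) h
  have hu := value_mem_Icc M (hX.pol_isPolicy t ht ω) (hX.f_mem t ht ω) h.succ (X.st t h.succ ω)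
  have hv := value_mem_Icc M (hX.pol_isPolicy t ht ω) (hX.f_mem t ht ω) h.castSucc
    (X.st t h.castSucc ω)
  simp only [Set.mem_Icc, Fin.val_succ, Fin.val_castSucc, Nat.cast_add, Nat.cast_one] at *
  have h1 : (0 : ℝ) ≤ (h : ℕ) := by positivity
  have h2 : (0 : ℝ) ≤ H := by positivity
  unfold stepDiff
  split_ifs
  · rw [abs_zero]
    linarith
  · rw [abs_le]
    constructor <;> linarith

variable [IsProbabilityMeasure μ]

lemma ae_act_eq (hX : IsAlgorithmRun μ M c aStar X) :
    ∀ᵐ ω ∂μ, ∀ t < c.T, ∀ h, StoppedBefore c X t h ω → X.act t h ω = aStar := by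
  classical
  rw [ae_all_iff]
  intro t
  rw [Filter.eventually_imp_distrib_left]
  intro ht
  rw [ae_all_iff]
  intro h
  have hle := (stateHist_le_actionHist X t h).trans (hX.actionHist_le t h)
  have hmeas : ∀ b, Measurable[stateHist X t h]
      fun ω => if StoppedBefore c X t h ω then (if b = aStar then (0 : ℝ) else 1) else 0 :=
    fun b => Measurable.ite (measurableSet_stoppedBefore c X t h) measurable_const measurable_const
  -- The test function is the indicator of having terminated and playing another action than
  -- `aStar`; `actionLaw` gives it mass zero.
  have hI := integral_comp_of_condLaw (B := 1) hle (hX.meas_act t h) (hX.law_act t ht h)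
    (φ := fun b ω => if StoppedBefore c X t h ω then (if b = aStar then (0 : ℝ) else 1) else 0)
    hmeas fun b ω => by split_ifs <;> simp
  have h0 : ∀ ω, ∑ b, (if StoppedBefore c X t h ω then (if b = aStar then (0 : ℝ) else 1) else 0)
      * actionLaw c aStar X t h ω b = 0 := fun ω => by
    refine Finset.sum_eq_zero fun b _ => ?_
    by_cases hs : StoppedBefore c X t h ω <;> by_cases hb : b = aStar <;>
      simp [actionLaw, pointMass, hs, hb]
  simp_rw [h0, integral_zero] at hI
  have hint : Integrable (fun ω => if StoppedBefore c X t h ω then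
      (if X.act t h ω = aStar then (0 : ℝ) else 1) else 0) μ := by
    refine Integrable.of_bound (C := 1) (measurable_eval_discrete
      (fun b => (hmeas b).mono hle le_rfl) (hX.meas_act t h)).aestronglyMeasurable ?_
    exact Filter.Eventually.of_forall fun ω => by split_ifs <;> simp
  rw [integral_eq_zero_iff_of_nonneg (fun ω => by positivity) hint] at hI
  filter_upwards [hI] with ω hω hs
  by_contra hne
  simp [hs, hne] at hω

/-- A weight known at the beginning of the episode is uncorrelated with the first deviation. -/
lemma integral_mul_initDiff (hX : IsAlgorithmRun μ M c aStar X) {t : ℕ} (ht : t < c.T)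
    {W : Ω → ℝ} (hW : Measurable[episodeHist X t] W) {B : ℝ} (hB : ∀ ω, |W ω| ≤ B) :
    ∫ ω, W ω * initDiff M c X t ω ∂μ = 0 := by
  classical
  have hV := hX.measurable_value ht
  have hVb := fun ω => value_mem_Icc M (hX.pol_isPolicy t ht ω) (hX.f_mem t ht ω) 0
  have hp := fun ω => sum_mem_Icc_of_isProbVec M.p_isProbVec (hVb ω)
  have hI := integral_comp_of_condLaw (B := B * H) (hX.episodeHist_le t) (hX.meas_st t 0)
    (hX.law_init t ht) (φ := fun s ω => W ω * if StoppedBy c X t ω then 0 else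
      value M (X.pol t ω) (X.f t ω) 0 s - ∑ s, M.p s * value M (X.pol t ω) (X.f t ω) 0 s)
    (fun s => hW.mul (Measurable.ite (measurableSet_stoppedBy c X t) measurable_const
      ((hV 0 s).sub (Finset.measurable_sum _ fun s _ => (hV 0 s).const_mul _))))
    (fun s ω => by
      have h1 := hVb ω s
      have h2 := hp ω
      simp only [Fin.val_zero, Nat.cast_zero, sub_zero, Set.mem_Icc] at h1 h2
      rw [abs_mul]
      refine mul_le_mul (hB ω) ?_ (abs_nonneg _) ((abs_nonneg _).trans (hB ω))
      split_ifs
      · simp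
      · rw [abs_le]
        constructor <;> linarith)
  refine hI.trans ?_
  rw [← integral_zero Ω ℝ (μ := μ)]
  congr 1
  funext ω
  by_cases hs : StoppedBy c X t ω
  · simp [hs]
  · simp_rw [hs, if_false, mul_assoc, ← Finset.mul_sum, sub_mul, Finset.sum_sub_distrib,
      ← Finset.mul_sum, M.p_isProbVec.2, mul_comm _ (M.p _)]
    simp

/-- Integrating out first the next state and then the action turns `f + V_{h+1}` into the right side
of the Bellman recursion, which cancels `V_h`. -/
lemma integral_mul_stepDiff (hX : IsAlgorithmRun μ M c aStar X) {t : ℕ} (ht : t < c.T)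
    (h : Fin H) {W : Ω → ℝ} (hW : Measurable[episodeHist X t] W) {B : ℝ} (hB : ∀ ω, |W ω| ≤ B) :
    ∫ ω, W ω * stepDiff M c X t h ω ∂μ = 0 := by
  classical
  have hES := episodeHist_le_stateHist X t h
  have hSA := stateHist_le_actionHist X t h
  have hle := hX.actionHist_le t h
  have hVS : ∀ i s, Measurable[stateHist X t h] fun ω => value M (X.pol t ω) (X.f t ω) i s :=
    fun i s => (hX.measurable_value ht i s).mono hES le_rfl
  have hst := measurable_st_stateHist X t (le_refl h.castSucc)
  have hf := (measurable_f_episodeHist X (le_refl t)).mono hES le_rfl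
  have hWS := hW.mono hES le_rfl
  have hV0 : Measurable[stateHist X t h]
      fun ω => value M (X.pol t ω) (X.f t ω) h.castSucc (X.st t h.castSucc ω) :=
    measurable_eval_discrete (φ := fun s ω => value M (X.pol t ω) (X.f t ω) h.castSucc s)
      (hVS _) hst
  have hVb := fun ω => value_mem_Icc M (hX.pol_isPolicy t ht ω) (hX.f_mem t ht ω)
  -- Used twice: `u` is the next value itself, then its mean under the kernel.
  have hbound : ∀ ω (r u v : ℝ), r ∈ Set.Icc (0 : ℝ) 1 → u ∈ Set.Icc 0 ((H : ℝ) - (h.succ : ℕ)) →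
      v ∈ Set.Icc 0 ((H : ℝ) - (h.castSucc : ℕ)) →
      |W ω * if ¬ StoppedBefore c X t h ω then r + u - v else 0| ≤ B * (1 + H) := by
    intro ω r u v hr hu hv
    rw [abs_mul]
    refine mul_le_mul (hB ω) ?_ (abs_nonneg _) ((abs_nonneg _).trans (hB ω))
    simp only [Set.mem_Icc, Fin.val_succ, Fin.val_castSucc, Nat.cast_add, Nat.cast_one] at *
    have h1 : (0 : ℝ) ≤ (h : ℕ) := by positivity
    have h2 : (0 : ℝ) ≤ H := by positivity
    split_ifs
    · rw [abs_zero]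
      linarith
    · rw [abs_le]
      constructor <;> linarith
  have hI1 := integral_comp_of_condLaw (B := B * (1 + H)) hle (hX.meas_st t h.succ)
    (hX.law_trans t ht h) (φ := fun y ω => W ω * if ¬ StoppedBefore c X t h ω then
      X.f t ω (X.st t h.castSucc ω) (X.act t h ω) h
        + value M (X.pol t ω) (X.f t ω) h.succ y
        - value M (X.pol t ω) (X.f t ω) h.castSucc (X.st t h.castSucc ω) else 0)
    (fun y => (hWS.mono hSA le_rfl).mul (Measurable.ite
      (hSA _ (measurableSet_stoppedBefore c X t h)).compl
      (((measurable_eval_sah (hf.mono hSA le_rfl) (hst.mono hSA le_rfl)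
        (measurable_act_actionHist X t h) h).add ((hVS _ y).mono hSA le_rfl)).sub
        (hV0.mono hSA le_rfl)) measurable_const))
    fun y ω => hbound ω _ _ _ (hX.f_mem t ht ω _ _ h) (hVb ω _ _) (hVb ω _ _)
  have hI2 := integral_comp_of_condLaw (B := B * (1 + H)) (hSA.trans hle) (hX.meas_act t h)
    (hX.law_act t ht h) (φ := fun b ω => W ω * if ¬ StoppedBefore c X t h ω then
      X.f t ω (X.st t h.castSucc ω) b h
        + ∑ y, M.P (X.st t h.castSucc ω) b h y * value M (X.pol t ω) (X.f t ω) h.succ y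
        - value M (X.pol t ω) (X.f t ω) h.castSucc (X.st t h.castSucc ω) else 0)
    (fun b => hWS.mul (Measurable.ite (measurableSet_stoppedBefore c X t h).compl
      (((measurable_eval_sah hf hst measurable_const h).add
        (Finset.measurable_sum _ fun y _ => (measurable_eval_discrete
          (φ := fun s _ => M.P s b h y) (fun s => measurable_const) hst).mul (hVS _ y))).sub
        hV0) measurable_const))
    fun b ω => hbound ω _ _ _ (hX.f_mem t ht ω _ _ h)
      (sum_mem_Icc_of_isProbVec (M.P_isKernel _ _ _) fun y => hVb ω _ _) (hVb ω _ _)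
  refine hI1.trans (Eq.trans ?_ (hI2.trans ?_))
  · congr 1
    funext ω
    by_cases hs : StoppedBefore c X t h ω
    · simp [hs]
    · simp_rw [hs, not_false_eq_true, if_true, mul_assoc, ← Finset.mul_sum, sub_mul, add_mul,
        Finset.sum_sub_distrib, Finset.sum_add_distrib, ← Finset.mul_sum,
        (M.P_isKernel _ _ _).2, mul_one, mul_comm (value _ _ _ _ _) (M.P _ _ _ _)]
  · rw [← integral_zero Ω ℝ (μ := μ)]
    congr 1
    funext ω
    by_cases hs : StoppedBefore c X t h ω
    · simp [hs]
    · simp_rw [actionLaw, hs, not_false_eq_true, if_true, if_false, mul_assoc, ← Finset.mul_sum,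
        sub_mul, Finset.sum_sub_distrib, ← Finset.mul_sum, (hX.pol_isPolicy t ht ω _ _).2,
        mul_one, mul_comm _ (X.pol _ _ _ _ _)]
      rw [← value_castSucc, sub_self, mul_zero]

lemma integral_mul_episodeDiff (hX : IsAlgorithmRun μ M c aStar X) {t : ℕ} (ht : t < c.T)
    {W : Ω → ℝ} (hW : Measurable[episodeHist X t] W) {B : ℝ} (hB : ∀ ω, |W ω| ≤ B) :
    ∫ ω, W ω * episodeDiff M c X t ω ∂μ = 0 := by
  have hle := hX.episodeHist_le (t + 1)
  have hWm := (hW.mono (hX.episodeHist_le t) le_rfl).aestronglyMeasurable (μ := μ)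
  have hs : ∀ h, Integrable (fun ω => W ω * stepDiff M c X t h ω) μ := fun h =>
    (Integrable.of_bound ((hX.measurable_stepDiff ht h).mono hle le_rfl).aestronglyMeasurable
      (1 + (H : ℝ)) (Filter.Eventually.of_forall (hX.abs_stepDiff_le ht h))).bdd_mul (c := B) hWm
      (Filter.Eventually.of_forall hB)
  have hd : Integrable (fun ω => W ω * episodeDiff M c X t ω) μ :=
    (Integrable.of_bound ((hX.measurable_episodeDiff ht).mono hle le_rfl).aestronglyMeasurable
      (H : ℝ) (Filter.Eventually.of_forall (hX.abs_episodeDiff_le ht))).bdd_mul (c := B) hWm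
      (Filter.Eventually.of_forall hB)
  have hsum : Integrable (fun ω => ∑ h, W ω * stepDiff M c X t h ω) μ :=
    integrable_finsetSum _ fun h _ => hs h
  -- Subtracting, instead of adding, spares the integrability of `W * initDiff`.
  have h1 : ∫ ω, W ω * episodeDiff M c X t ω ∂μ - ∫ ω, ∑ h, W ω * stepDiff M c X t h ω ∂μ
      = ∫ ω, W ω * initDiff M c X t ω ∂μ := by
    rw [← integral_sub hd hsum]
    congr 1
    funext ω
    rw [episodeDiff, ← Finset.mul_sum]
    ring
  rw [integral_finsetSum _ fun h _ => hs h, hX.integral_mul_initDiff ht hW hB,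
    Finset.sum_eq_zero fun h _ => hX.integral_mul_stepDiff ht h hW hB, sub_zero] at h1
  exact h1

/-! ### Concentration -/

omit [DiscreteMeasurableSpace S] [DiscreteMeasurableSpace A] [IsProbabilityMeasure μ] in
lemma abs_sum_episodeDiff_le (hX : IsAlgorithmRun μ M c aStar X) {n : ℕ} (hn : n ≤ c.T) (ω : Ω) :
    |∑ t ∈ Finset.range n, episodeDiff M c X t ω| ≤ n * H := by
  refine (Finset.abs_sum_le_sum_abs _ _).trans ((Finset.sum_le_sum fun t ht =>
    hX.abs_episodeDiff_le ((Finset.mem_range.1 ht).trans_le hn) ω).trans ?_)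
  simp

omit [IsProbabilityMeasure μ] in
lemma measurable_sum_episodeDiff (hX : IsAlgorithmRun μ M c aStar X) {n : ℕ} (hn : n ≤ c.T) :
    Measurable[episodeHist X n] fun ω => ∑ t ∈ Finset.range n, episodeDiff M c X t ω :=
  Finset.measurable_sum _ fun t ht => by
    have ht' := Finset.mem_range.1 ht
    exact (hX.measurable_episodeDiff (ht'.trans_le hn)).mono (episodeHist_mono X ht') le_rfl

omit [DiscreteMeasurableSpace S] [DiscreteMeasurableSpace A] [IsProbabilityMeasure μ] in
lemma exp_mul_sum_le (hX : IsAlgorithmRun μ M c aStar X) (s : ℝ) {n : ℕ} (hn : n ≤ c.T) (ω : Ω) :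
    |Real.exp (s * ∑ t ∈ Finset.range n, episodeDiff M c X t ω)| ≤
      Real.exp (|s| * (n * H)) := by
  rw [Real.abs_exp, Real.exp_le_exp]
  refine (le_abs_self _).trans ?_
  rw [abs_mul]
  exact mul_le_mul_of_nonneg_left (hX.abs_sum_episodeDiff_le hn ω) (abs_nonneg s)

omit [IsProbabilityMeasure μ] in
lemma measurable_exp_mul_sum (hX : IsAlgorithmRun μ M c aStar X) (s : ℝ) {n : ℕ} (hn : n ≤ c.T) :
    Measurable[episodeHist X n]
      fun ω => Real.exp (s * ∑ t ∈ Finset.range n, episodeDiff M c X t ω) :=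
  Real.measurable_exp.comp ((hX.measurable_sum_episodeDiff hn).const_mul s)

lemma integrable_exp_mul_sum (hX : IsAlgorithmRun μ M c aStar X) (s : ℝ) {n : ℕ} (hn : n ≤ c.T) :
    Integrable (fun ω => Real.exp (s * ∑ t ∈ Finset.range n, episodeDiff M c X t ω)) μ :=
  Integrable.of_bound
    ((hX.measurable_exp_mul_sum s hn).mono (hX.episodeHist_le n) le_rfl).aestronglyMeasurable
    _ (Filter.Eventually.of_forall (hX.exp_mul_sum_le s hn))

/-- By convexity `exp (x y) ≤ cosh y + x sinh y` for `|x| ≤ 1`. With `x` the last increment over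
`H`, the linear term is orthogonal to the past, so each episode costs a factor `cosh (s H)`. -/
lemma integral_exp_mul_sum_le (hX : IsAlgorithmRun μ M c aStar X) (s : ℝ) {n : ℕ} (hn : n ≤ c.T) :
    ∫ ω, Real.exp (s * ∑ t ∈ Finset.range n, episodeDiff M c X t ω) ∂μ ≤
      Real.cosh (s * H) ^ n := by
  induction n with
  | zero => simp
  | succ n ih =>
    have hn' : n < c.T := hn
    set W := fun ω => Real.exp (s * ∑ t ∈ Finset.range n, episodeDiff M c X t ω) with hWdef
    have hW := hX.measurable_exp_mul_sum s hn'.le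
    have hWb := hX.exp_mul_sum_le s hn'.le
    have hWi := hX.integrable_exp_mul_sum s hn'.le
    have hD := hX.integral_mul_episodeDiff hn' hW hWb
    have hDi : Integrable (fun ω => W ω * episodeDiff M c X n ω) μ :=
      (Integrable.of_bound ((hX.measurable_episodeDiff hn').mono (hX.episodeHist_le _)
        le_rfl).aestronglyMeasurable (H : ℝ)
        (Filter.Eventually.of_forall (hX.abs_episodeDiff_le hn'))).bdd_mul
        hWi.aestronglyMeasurable (Filter.Eventually.of_forall hWb)
    have hpt : ∀ ω, Real.exp (s * ∑ t ∈ Finset.range (n + 1), episodeDiff M c X t ω) ≤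
        Real.cosh (s * H) * W ω + Real.sinh (s * H) / H * (W ω * episodeDiff M c X n ω) := by
      intro ω
      have h1 := hX.abs_episodeDiff_le hn' ω
      have h2 : |episodeDiff M c X n ω / H| ≤ 1 := by
        rw [abs_div, Nat.abs_cast]
        exact div_le_one_of_le₀ h1 (Nat.cast_nonneg _)
      have h3 : episodeDiff M c X n ω / H * (s * H) = s * episodeDiff M c X n ω := by
        -- For `H = 0` the quotient is `0` by convention, and so is the increment.
        rcases eq_or_ne (H : ℝ) 0 with h0 | h0
        · rw [h0] at h1
          rw [abs_nonpos_iff.1 h1]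
          simp
        · field_simp
      have h4 := Real.exp_mul_le_cosh_add_mul_sinh h2 (s * H)
      rw [h3] at h4
      rw [Finset.sum_range_succ, mul_add, Real.exp_add]
      calc _ ≤ W ω * (Real.cosh (s * H) + episodeDiff M c X n ω / H * Real.sinh (s * H)) :=
            mul_le_mul_of_nonneg_left h4 (Real.exp_pos _).le
        _ = _ := by ring
    calc _ ≤ ∫ ω, (Real.cosh (s * H) * W ω +
          Real.sinh (s * H) / H * (W ω * episodeDiff M c X n ω)) ∂μ :=
          integral_mono (hX.integrable_exp_mul_sum s hn)
            ((hWi.const_mul _).add (hDi.const_mul _)) hpt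
      _ = Real.cosh (s * H) * ∫ ω, W ω ∂μ := by
          rw [integral_add (hWi.const_mul _) (hDi.const_mul _), integral_const_mul,
            integral_const_mul, hD, mul_zero, add_zero]
      _ ≤ Real.cosh (s * H) * Real.cosh (s * H) ^ n :=
          mul_le_mul_of_nonneg_left (ih hn'.le) (Real.cosh_pos _).le
      _ = _ := (pow_succ' _ _).symm

/-- One-sided Azuma–Hoeffding bound, for either sign `σ`. -/
lemma measure_sum_episodeDiff_ge_le (hX : IsAlgorithmRun μ M c aStar X) (hH : 0 < H)
    (hT : 0 < c.T) {ℓ : ℝ} (hℓ : 0 ≤ ℓ) {σ : ℝ} (hσ : σ ^ 2 = 1) :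
    μ.real {ω | H * Real.sqrt (2 * c.T * ℓ) ≤
      σ * ∑ t ∈ Finset.range c.T, episodeDiff M c X t ω} ≤ Real.exp (-ℓ) := by
  have hT' : (0 : ℝ) < c.T := Nat.cast_pos.2 hT
  have hH' : (0 : ℝ) < H := Nat.cast_pos.2 hH
  set r := Real.sqrt (2 * c.T * ℓ) with hr
  have hr2 : r ^ 2 = 2 * c.T * ℓ := Real.sq_sqrt (by positivity)
  -- The minimizer of the Chernoff exponent `-s H r + T (s H)² / 2`, whose minimum is `-r² / (2T) =
  -- -ℓ`.
  set s := r / (c.T * H) with hs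
  have hs0 : 0 ≤ s := by positivity
  have hint := hX.integrable_exp_mul_sum (s * σ) le_rfl
  have h1 := measure_ge_le_exp_mul_mgf (μ := μ)
    (X := fun ω => σ * ∑ t ∈ Finset.range c.T, episodeDiff M c X t ω) (H * r) hs0
    (by simpa only [← mul_assoc] using hint)
  refine h1.trans ?_
  have h2 : mgf (fun ω => σ * ∑ t ∈ Finset.range c.T, episodeDiff M c X t ω) μ s ≤
      Real.exp (c.T * ((s * σ * H) ^ 2 / 2)) := by
    simp only [mgf, ← mul_assoc]
    refine (hX.integral_exp_mul_sum_le (s * σ) le_rfl).trans ?_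
    rw [Real.exp_nat_mul]
    exact pow_le_pow_left₀ (Real.cosh_pos _).le (Real.cosh_le_exp_half_sq _) _
  calc _ ≤ Real.exp (-s * (H * r)) * Real.exp (c.T * ((s * σ * H) ^ 2 / 2)) :=
        mul_le_mul_of_nonneg_left h2 (Real.exp_pos _).le
    _ = Real.exp (-ℓ) := by
        rw [← Real.exp_add]
        congr 1
        have h3 : -s * (H * r) = -(r ^ 2 / c.T) := by
          rw [hs]
          field_simp
        have h4 : (c.T : ℝ) * ((s * σ * H) ^ 2 / 2) = r ^ 2 / c.T / 2 := by
          rw [mul_pow, mul_pow, hσ, hs]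
          field_simp
        rw [h3, h4, hr2]
        field_simp
        ring

/-- A union bound over the two signs; the extra `H` pays for the terminating episode. -/
lemma measure_abs_gap_le (hX : IsAlgorithmRun μ M c aStar X) (hH : 0 < H) (hT : 0 < c.T) {ℓ : ℝ}
    (hℓ : 0 ≤ ℓ) :
    1 - 2 * Real.exp (-ℓ) ≤ μ.real {ω | |expectedReward M c X ω - realizedReward c X ω| ≤
      H * Real.sqrt (2 * c.T * ℓ) + H} := by
  set Z := fun ω => ∑ t ∈ Finset.range c.T, episodeDiff M c X t ω
  set ε := H * Real.sqrt (2 * c.T * ℓ)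
  have h1 := hX.measure_sum_episodeDiff_ge_le hH hT hℓ (σ := 1) (by norm_num)
  have h2 := hX.measure_sum_episodeDiff_ge_le hH hT hℓ (σ := -1) (by norm_num)
  have hZ : Measurable Z := (hX.measurable_sum_episodeDiff le_rfl).mono (hX.episodeHist_le _) le_rfl
  have hbad : MeasurableSet ({ω | ε ≤ 1 * Z ω} ∪ {ω | ε ≤ -1 * Z ω}) :=
    (measurableSet_le measurable_const (hZ.const_mul _)).union
      (measurableSet_le measurable_const (hZ.const_mul _))
  have h3 := probReal_compl_eq_one_sub (μ := μ) hbad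
  have h4 := measureReal_union_le (μ := μ) {ω | ε ≤ 1 * Z ω} {ω | ε ≤ -1 * Z ω}
  have h5 : μ.real ({ω | ε ≤ 1 * Z ω} ∪ {ω | ε ≤ -1 * Z ω})ᶜ ≤
      μ.real {ω | |expectedReward M c X ω - realizedReward c X ω| ≤ ε + H} := by
    -- The inclusion holds only almost everywhere, since the default action is played after
    -- termination only almost surely.
    refine ENNReal.toReal_mono (measure_ne_top _ _) (measure_mono_ae ?_)
    filter_upwards [hX.ae_act_eq] with ω hω hmem
    have h6 : |Z ω| ≤ ε := by
      have : ¬ (ω ∈ {ω | ε ≤ 1 * Z ω} ∪ {ω | ε ≤ -1 * Z ω}) := hmem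
      simp only [Set.mem_union, Set.mem_ofPred_eq, not_or, not_le] at this
      rw [abs_le]
      constructor <;> linarith [this.1, this.2]
    have h7 : realizedReward c X ω - expectedReward M c X ω - Z ω =
        ∑ t ∈ Finset.range c.T, (episodeGap M X t ω - episodeDiff M c X t ω) := by
      simp only [Z, realizedReward, expectedReward, episodeGap, Finset.sum_sub_distrib]
    have h8 := (Finset.abs_sum_le_sum_abs _ _).trans (hX.sum_abs_gap_sub_diff_le hω le_rfl).1
    rw [← h7] at h8
    change |expectedReward M c X ω - realizedReward c X ω| ≤ ε + H
    rw [abs_le] at *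
    constructor <;> linarith [h6.1, h6.2, h8.1, h8.2]
  change μ.real {ω | ε ≤ 1 * Z ω} ≤ _ at h1
  change μ.real {ω | ε ≤ -1 * Z ω} ≤ _ at h2
  linarith

end IsAlgorithmRun

end Martingale

end EpisodicMDP

/-! ### Choice of `ℓ = ln(1/δ)` and of the constant. -/

theorem mainTheorem4 :
    ∃ C : ℝ, 0 < C ∧
      ∀ (S A Ω : Type*) [Fintype S] [Fintype A]
        [MeasurableSpace S] [DiscreteMeasurableSpace S]
        [MeasurableSpace A] [DiscreteMeasurableSpace A] [MeasurableSpace Ω]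
        (μ : MeasureTheory.Measure Ω) [MeasureTheory.IsProbabilityMeasure μ]
        (H : ℕ) (M : EpisodicMDP.MDP S A H) (c : EpisodicMDP.Params) (aStar : A)
        (X : EpisodicMDP.Run S A Ω H),
        EpisodicMDP.IsAlgorithmRun μ M c aStar X →
          1 - 5 * c.δ ≤ μ.real {ω |
            |EpisodicMDP.expectedReward M c X ω - EpisodicMDP.realizedReward c X ω| ≤
              C * ((H : ℝ) * Real.sqrt c.T
                  + (H : ℝ) ^ 2 * Fintype.card S * Real.sqrt (Fintype.card A))
                * (Real.log ((H : ℝ) * Fintype.card S * Fintype.card A * c.T / c.δ)) ^ 2} := by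
  -- `3 = 2 + 1`: `2` from the deviation, `1` from the terminating episode.
  refine ⟨3, by norm_num, ?_⟩
  intro S A Ω _ _ _ _ _ _ _ μ _ H M c aStar X hX
  have hδ := c.δ_pos
  -- For `δ ≥ 1/5` the claimed probability is not positive; below, `e < 5` gives `ln(1/δ) ≥ 1`, so
  -- that powers of the logarithm can be raised freely.
  rcases le_or_gt (1 / 5) c.δ with hδ5 | hδ5
  · exact (by linarith : 1 - 5 * c.δ ≤ 0).trans measureReal_nonneg
  rcases Nat.eq_zero_or_pos c.T with hT | hT
  · simp [EpisodicMDP.expectedReward, EpisodicMDP.realizedReward, hT, hδ.le]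
  rcases Nat.eq_zero_or_pos H with rfl | hH
  · simp [EpisodicMDP.expectedReward, EpisodicMDP.realizedReward, EpisodicMDP.dot, hδ.le]
  have hS : 0 < Fintype.card S := by
    refine Fintype.card_pos_iff.2 (not_isEmpty_iff.1 fun hS => ?_)
    have := M.p_isProbVec.2
    simp at this
  have hA : 0 < Fintype.card A := Fintype.card_pos_iff.2 ⟨aStar⟩
  have hT1 : (1 : ℝ) ≤ c.T := Nat.one_le_cast.2 hT
  have hn : (1 : ℝ) ≤ (H : ℝ) * Fintype.card S * Fintype.card A * c.T :=
    mod_cast Nat.mul_pos (Nat.mul_pos (Nat.mul_pos hH hS) hA) hT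
  set L := Real.log ((H : ℝ) * Fintype.card S * Fintype.card A * c.T / c.δ) with hL
  have hℓ1 : 1 ≤ Real.log (1 / c.δ) := by
    rw [Real.le_log_iff_exp_le (by positivity), le_div_iff₀ hδ]
    nlinarith [Real.exp_one_lt_d9, Real.exp_pos 1]
  have hℓL : Real.log (1 / c.δ) ≤ L := Real.log_le_log (by positivity) (by gcongr)
  have hmain := hX.measure_abs_gap_le hH hT (zero_le_one.trans hℓ1)
  have hexp : Real.exp (-Real.log (1 / c.δ)) = c.δ := by
    rw [one_div, Real.log_inv, neg_neg, Real.exp_log hδ]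
  rw [hexp] at hmain
  refine (by linarith : 1 - 5 * c.δ ≤ 1 - 2 * c.δ).trans (hmain.trans (measureReal_mono ?_))
  intro ω hω
  rw [Set.mem_ofPred_eq] at hω ⊢
  refine hω.trans ?_
  have hL1 : 1 ≤ L := hℓ1.trans hℓL
  have hsqrt : Real.sqrt (2 * c.T * Real.log (1 / c.δ)) ≤ Real.sqrt c.T * (2 * L ^ 2) := by
    rw [Real.sqrt_le_left (by positivity), mul_pow, Real.sq_sqrt (by positivity)]
    -- Since `L ≥ 1`, one has `2 ln(1/δ) ≤ 2L ≤ 4L⁴`.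
    have : 2 * Real.log (1 / c.δ) ≤ (2 * L ^ 2) ^ 2 := by nlinarith [sq_nonneg (L ^ 2 - 1)]
    nlinarith
  have hsT : 1 ≤ Real.sqrt c.T := Real.one_le_sqrt.2 hT1
  have hL2 : 1 ≤ L ^ 2 := one_le_pow₀ hL1
  have hH0 : (0 : ℝ) ≤ H := Nat.cast_nonneg _
  calc (H : ℝ) * Real.sqrt (2 * c.T * Real.log (1 / c.δ)) + H
      ≤ H * (Real.sqrt c.T * (2 * L ^ 2)) + H * (Real.sqrt c.T * L ^ 2) := by
        gcongr
        exact le_mul_of_one_le_right hH0 (one_le_mul_of_one_le_of_one_le hsT hL2)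
    _ = 3 * (H * Real.sqrt c.T) * L ^ 2 := by ring
    _ ≤ _ := by
        gcongr
        exact le_add_of_nonneg_right (by positivity)
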